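/- Let $H$ be a complex Hilbert space, let $A$ be a positive definite (that is, positive and invertible) bounded linear operator on $H$, and let $B$ be a positive semidefinite bounded linear operator on $H$. Let $m,n,k$ be positive integers and let $t\in[0,1]$. Let $r$ be a real number such that $$ \begin{cases} r\ge t, & \text{if } (1-t)n\ge (m-t)k,\\ r\ge \max\left\{\dfrac{(m-t)k-(1-t)n}{n-1},\,t\right\}, & \text{if } (m-t)k\ge (1-t)n \text{ and } n\ge 2 \end{cases} $$ (so that at least one of the two cases applies and its condition holds; where both apply, the two conditions on $r$ coincide). Then there exists a positive semidefinite bounded linear operator $X$ on $H$ such that $$ \sum_{j=1}^{n}A^{n-j}XA^{j-1} = A^{\frac{nr}{2(m-t)k+2r}}\left\{\sum_{i=1}^{k}A^{\frac{n(m-t)(k-i)}{(m-t)k+r}}\left[A^{-\frac t2\cdot\frac{n}{(m-t)k+r}}\left(\sum_{j=1}^{m}A^{\frac{n(m-j)}{(m-t)k+r}}BA^{\frac{n(j-1)}{(m-t)k+r}}\right)A^{-\frac t2\cdot\frac{n}{(m-t)k+r}}\right]A^{\frac{n(m-t)(i-1)}{(m-t)k+r}}\right\}A^{\frac{nr}{2(m-t)k+2r}},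 $$ where the real powers of $A$ are given by the continuous functional calculus. -/

import Mathlib

/-! The right side is a derivative. Put `δ = (m - t) * k + r`, `C = A ^ (n / δ)` and `Y x = C ^ (r /
2) * (C ^ (-(t / 2)) * (C + x • B) ^ m * C ^ (-(t / 2))) ^ k * C ^ (r / 2)`. Then `Y 0 = A ^ n`, and
the product rule turns `Y' 0` into the given double sum. Since `C ≤ C + x • B`, `grand_furuta` and
Löwner–Heinz give `A ≤ Z x` for the `n`-th root `Z` of `Y` and `x > 0`; the condition on `r`
supplies the exponent bound needed. The quotients `(Z x - A) / x` are thus positive, and bounded by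
`IsStrictlyPositive.exists_norm_rpow_inv_sub_le`. A weak limit of them is `X`, and expanding `Z ^ n
= Y` to first order at `A` gives the equation. -/

section Furuta

/-! ### Real powers of strictly positive elements. -/

variable {𝒜 : Type*} [CStarAlgebra 𝒜] [PartialOrder 𝒜] [StarOrderedRing 𝒜]

/-- The law `(a ^ x) ^ y = a ^ (x * y)` for strictly positive `a`, including `x = 0`. -/
lemma IsStrictlyPositive.rpow_mul {a : 𝒜} (ha : IsStrictlyPositive a) (x y : ℝ) :
    (a ^ x) ^ y = a ^ (x * y) := by
  rcases eq_or_ne x 0 with rfl | hx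
  · rw [zero_mul, CFC.rpow_zero a ha.nonneg, CFC.one_rpow]
  · exact CFC.rpow_rpow a x y hx ha

lemma IsStrictlyPositive.rpow_mul_rpow {a : 𝒜} (ha : IsStrictlyPositive a) {x y z : ℝ}
    (h : x + y = z) : a ^ x * a ^ y = a ^ z := by
  rw [← h, CFC.rpow_add ha.isUnit]

lemma IsStrictlyPositive.rpow_mul_rpow_mul {a : 𝒜} (ha : IsStrictlyPositive a) {x y z : ℝ}
    (h : x + y = z) (b : 𝒜) : a ^ x * (a ^ y * b) = a ^ z * b := by
  rw [← mul_assoc, ha.rpow_mul_rpow h]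

lemma IsStrictlyPositive.rpow_rpow_eq_self {a : 𝒜} (ha : IsStrictlyPositive a) {x y : ℝ}
    (h : x * y = 1) : (a ^ x) ^ y = a := by
  rw [ha.rpow_mul, h, CFC.rpow_one a ha.nonneg]

/-- The map `a ↦ a ^ s` is operator antitone for `s ∈ [-1, 0]`. -/
lemma IsStrictlyPositive.rpow_le_rpow_of_nonpos {a b : 𝒜} (ha : IsStrictlyPositive a)
    (hab : a ≤ b) {s : ℝ} (h1 : -1 ≤ s) (h0 : s ≤ 0) : b ^ s ≤ a ^ s := by
  have hb : IsStrictlyPositive b := ha.of_le hab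
  rcases h0.eq_or_lt with rfl | hs
  · rw [CFC.rpow_zero a ha.nonneg, CFC.rpow_zero b hb.nonneg]
  · have key := CStarAlgebra.ringInverse_le_ringInverse
      (CFC.rpow_le_rpow (p := -s) ⟨by linarith, by linarith⟩ hab) (ha.rpow a (-s))
    rwa [CFC.inverse_rpow a (-s) (by linarith) ha, CFC.inverse_rpow b (-s) (by linarith) hb,
      neg_neg] at key

lemma IsStrictlyPositive.conj_rpow {a b : 𝒜} (hb : IsStrictlyPositive b)
    (ha : IsStrictlyPositive a) (x : ℝ) : IsStrictlyPositive (b ^ x * a * b ^ x) :=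
  IsStrictlyPositive.conjugate_of_isUnit_of_isSelfAdjoint a (b ^ x) (hb.rpow b x).isUnit
    (hb.rpow b x).isSelfAdjoint ha

/-- For invertible `T`, powers of `T T⋆` are expressed through powers of `T⋆ T`. -/
lemma IsUnit.mul_star_self_rpow {T : 𝒜} (hT : IsUnit T) (s : ℝ) :
    (T * star T) ^ s = T * (star T * T) ^ (s - 1) * star T := by
  set c := star T * T with hc
  have hcp : IsStrictlyPositive c := (hT.star.mul hT).isStrictlyPositive (star_mul_self_nonneg T)
  set d := c ^ (-(1 / 2) : ℝ) with hd
  have hds : star d = d := (hcp.rpow c _).isSelfAdjoint.star_eq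
  have hdcd : d * c * d = 1 := CFC.conjugate_rpow_neg_one_half c hcp
  have h1 : star (T * d) * (T * d) = 1 := by
    rw [star_mul, hds, ← hdcd, hc]; simp only [mul_assoc]
  have hunit : IsUnit (T * d) := hT.mul (hcp.rpow c _).isUnit
  have h2 : (T * d) * star (T * d) = 1 := by
    obtain ⟨u, hu⟩ := hunit
    rw [← hu] at h1 ⊢
    have : star (u : 𝒜) = ↑u⁻¹ := (Units.inv_eq_of_mul_eq_one_left h1).symm
    rw [this, Units.mul_inv]
  -- The unitary polar factor of `T`: conjugation by it carries `T⋆ T` to `T T⋆` and commutes with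
  -- the functional calculus.
  let U : unitary 𝒜 := ⟨T * d, Unitary.mem_iff.mpr ⟨h1, h2⟩⟩
  have hconj : ∀ x, Unitary.conjStarAlgAut ℂ 𝒜 U x = T * (d * x * d) * star T := by
    intro x
    rw [Unitary.conjStarAlgAut_apply]
    simp only [U, star_mul, hds, mul_assoc]
  have hTT : Unitary.conjStarAlgAut ℂ 𝒜 U c = T * star T := by
    rw [hconj, hdcd, mul_one]
  have hmap : Unitary.conjStarAlgAut ℂ 𝒜 U (c ^ s) = (T * star T) ^ s := by
    rw [CFC.rpow_eq_cfc_real hcp.nonneg, CFC.rpow_eq_cfc_real (mul_star_self_nonneg T), ← hTT]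
    refine StarAlgHomClass.map_cfc (S := ℂ) (Unitary.conjStarAlgAut ℂ 𝒜 U) _ c ?_ ?_ ?_ ?_
    · intro x hx
      exact (Real.continuousAt_rpow_const x s
        (Or.inl (hcp.spectrum_pos hx).ne')).continuousWithinAt
    · change Continuous fun x => Unitary.conjStarAlgAut ℂ 𝒜 U x
      simp only [hconj]
      fun_prop
    · exact hcp.isSelfAdjoint
    · rw [hTT]; exact IsSelfAdjoint.mul_star_self T
  rw [← hmap, hconj, hcp.rpow_mul_rpow rfl, hcp.rpow_mul_rpow rfl]
  congr 3
  ring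

/-- Conjugating form of `IsUnit.mul_star_self_rpow` for `T = b ^ x * a ^ (p / 2)`. -/
lemma IsStrictlyPositive.conj_rpow_rpow {a b : 𝒜} (ha : IsStrictlyPositive a)
    (hb : IsStrictlyPositive b) (p x s : ℝ) :
    (b ^ x * a ^ p * b ^ x) ^ s = b ^ x * (a ^ (p / 2) *
      (a ^ (p / 2) * b ^ (2 * x) * a ^ (p / 2)) ^ (s - 1) * a ^ (p / 2)) * b ^ x := by
  have key := ((hb.rpow b x).isUnit.mul (ha.rpow a (p / 2)).isUnit).mul_star_self_rpow s
  rw [star_mul, (hb.rpow b x).isSelfAdjoint.star_eq,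
    (ha.rpow a (p / 2)).isSelfAdjoint.star_eq] at key
  simp only [mul_assoc] at key ⊢
  rwa [ha.rpow_mul_rpow_mul (add_halves p), hb.rpow_mul_rpow_mul (two_mul x).symm] at key

/-! ### Furuta and grand Furuta inequalities. -/

/-- Furuta's inequality for `r ∈ [0, 1]`. -/
lemma furuta_of_le_one {P Q : 𝒜} (hQ : IsStrictlyPositive Q) (hQP : Q ≤ P) {p r : ℝ}
    (hp : 1 ≤ p) (hr0 : 0 ≤ r) (hr1 : r ≤ 1) :
    Q ^ (1 + r) ≤ (Q ^ (r / 2) * P ^ p * Q ^ (r / 2)) ^ ((1 + r) / (p + r)) := by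
  have hP : IsStrictlyPositive P := hQ.of_le hQP
  have hpr : 0 < p + r := by linarith
  set s := (1 + r) / (p + r) with hs
  have hs0 : 0 ≤ s := by positivity
  have hs1 : s ≤ 1 := by rw [hs, div_le_one hpr]; linarith
  have hsm : (p + r) * s = 1 + r := by rw [hs]; field_simp
  -- The exponent becomes `s - 1 ∈ [-1, 0]`, where powers are antitone, so an upper bound on the
  -- inner factor suffices. The powers of `P` then add up to `p + (p + r) * (s - 1) = 1`.
  rw [hP.conj_rpow_rpow hQ, show 2 * (r / 2) = r by ring]
  have h1 : P ^ (p / 2) * Q ^ r * P ^ (p / 2) ≤ P ^ (p + r) := by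
    have := conjugate_le_conjugate_of_nonneg (CFC.rpow_le_rpow (p := r) ⟨hr0, hr1⟩ hQP)
      (hP.rpow P (p / 2)).nonneg
    rwa [hP.rpow_mul_rpow rfl, hP.rpow_mul_rpow (z := p + r) (by ring)] at this
  have h2 := (hP.conj_rpow (hQ.rpow Q r) (p / 2)).rpow_le_rpow_of_nonpos h1
    (s := s - 1) (by linarith) (by linarith)
  rw [hP.rpow_mul] at h2
  have h3 := conjugate_le_conjugate_of_nonneg h2 (hP.rpow P (p / 2)).nonneg
  rw [hP.rpow_mul_rpow rfl, hP.rpow_mul_rpow (z := 1) (by linarith), CFC.rpow_one P hP.nonneg] at h3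
  have h4 := conjugate_le_conjugate_of_nonneg (hQP.trans h3) (hQ.rpow Q (r / 2)).nonneg
  have h5 : Q ^ (r / 2) * Q ^ (1 : ℝ) * Q ^ (r / 2) = Q ^ (1 + r) := by
    rw [hQ.rpow_mul_rpow rfl, hQ.rpow_mul_rpow (z := 1 + r) (by ring)]
  rw [CFC.rpow_one Q hQ.nonneg] at h5
  rwa [h5] at h4

/-- **Furuta's inequality** for strictly positive elements of a C⋆-algebra. -/
theorem furuta {P Q : 𝒜} (hQ : IsStrictlyPositive Q) (hQP : Q ≤ P) {p r : ℝ}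
    (hp : 1 ≤ p) (hr : 0 ≤ r) :
    Q ^ (1 + r) ≤ (Q ^ (r / 2) * P ^ p * Q ^ (r / 2)) ^ ((1 + r) / (p + r)) := by
  obtain ⟨N, hN⟩ := exists_nat_ge r
  induction N generalizing r with
  | zero => exact furuta_of_le_one hQ hQP hp hr (hN.trans (by simp))
  | succ N ih =>
    rcases le_total r N with h | h
    · exact ih hr h
    have hN0 : (0 : ℝ) ≤ N := N.cast_nonneg
    have hP : IsStrictlyPositive P := hQ.of_le hQP
    have hN1 : r ≤ N + 1 := by simpa using hN
    have hW := hQ.conj_rpow (hP.rpow P p) (N / 2)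
    have hpN : (0 : ℝ) < p + N := by linarith
    -- The induction hypothesis at `r = N` is itself an order relation, with `Q ^ (1 + N)` as the
    -- smaller element. The new `p` undoes the root on the larger one; the new `r` supplies the
    -- missing `r - N`.
    have key := furuta_of_le_one (hQ.rpow Q (1 + N)) (ih hN0 le_rfl)
      (p := (p + N) / (1 + N)) (r := (r - N) / (1 + N))
      (by rw [le_div_iff₀ (by positivity)]; linarith)
      (div_nonneg (by linarith) (by positivity))
      (by rw [div_le_one (by positivity)]; linarith)
    rw [hW.rpow_rpow_eq_self (by field_simp), hQ.rpow_mul, hQ.rpow_mul] at key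
    have e1 : (1 + N : ℝ) * (1 + (r - N) / (1 + N)) = 1 + r := by field_simp; ring
    have e2 : (1 + N : ℝ) * ((r - N) / (1 + N) / 2) = (r - N) / 2 := by field_simp
    have e3 : (1 + (r - N) / (1 + N)) / ((p + N) / (1 + N) + (r - N) / (1 + N)) =
        (1 + r) / (p + r) := by
      have : p + r ≠ 0 := by linarith
      rw [← add_div, show p + N + (r - N) = p + r by ring]
      field_simp
      ring
    rw [e1, e2, e3] at key
    simp only [mul_assoc] at key ⊢
    rwa [hQ.rpow_mul_rpow (z := r / 2) (by ring), hQ.rpow_mul_rpow_mul (z := r / 2) (by ring)]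
      at key

/-- One step of the grand Furuta inequality: the exponent `s` ranges over `[1, 2]`. -/
lemma rpow_le_conj_rpow_conj {P Q : 𝒜} (hQ : IsStrictlyPositive Q) (hQP : Q ≤ P) {p s t : ℝ}
    (ht0 : 0 ≤ t) (ht1 : t ≤ 1) (hs1 : 1 ≤ s) (hs2 : s ≤ 2) :
    P ^ ((p - t) * s + t) ≤
      Q ^ (t / 2) * (Q ^ (-(t / 2)) * P ^ p * Q ^ (-(t / 2))) ^ s * Q ^ (t / 2) := by
  have hP : IsStrictlyPositive P := hQ.of_le hQP
  have h1 : P ^ (p - t) ≤ P ^ (p / 2) * Q ^ (-t) * P ^ (p / 2) := by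
    have := conjugate_le_conjugate_of_nonneg
      (hQ.rpow_le_rpow_of_nonpos hQP (s := -t) (by linarith) (by linarith))
      (hP.rpow P (p / 2)).nonneg
    rwa [hP.rpow_mul_rpow rfl, hP.rpow_mul_rpow (z := p - t) (by ring)] at this
  have h2 := conjugate_le_conjugate_of_nonneg
    (CFC.rpow_le_rpow (p := s - 1) ⟨by linarith, by linarith⟩ h1) (hP.rpow P (p / 2)).nonneg
  rw [hP.rpow_mul, hP.rpow_mul_rpow rfl,
    hP.rpow_mul_rpow (z := (p - t) * s + t) (by ring)] at h2
  -- The right side is already the goal: `conj_rpow_rpow` trades the power `s` for `s - 1`, and the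
  -- outer powers of `Q` cancel.
  refine h2.trans_eq ?_
  rw [hP.conj_rpow_rpow hQ, show 2 * (-(t / 2)) = -t by ring]
  have e : Q ^ (-(t / 2)) * Q ^ (t / 2) = 1 := CFC.rpow_neg_mul_rpow _ hQ
  simp only [mul_assoc, e, mul_one]
  rw [hQ.rpow_mul_rpow_mul (z := 0) (by ring), CFC.rpow_zero Q hQ.nonneg, one_mul]

/-- Induction on `k`, with equality at `k = 0`. Raising the inner power from `j + 1` to `j + 2` is a
real power with exponent at most `2`, so `rpow_le_conj_rpow_conj` applies with `P` replaced by the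
current root; the roots therefore increase. -/
lemma le_conj_pow_conj_rpow {P Q : 𝒜} (hQ : IsStrictlyPositive Q) (hQP : Q ≤ P) {p t : ℝ}
    (hp : 1 ≤ p) (ht0 : 0 ≤ t) (ht1 : t ≤ 1) (k : ℕ) :
    P ≤ (Q ^ (t / 2) * (Q ^ (-(t / 2)) * P ^ p * Q ^ (-(t / 2))) ^ (k + 1) * Q ^ (t / 2)) ^
      ((p - t) * (k + 1 : ℕ) + t)⁻¹ := by
  have hP : IsStrictlyPositive P := hQ.of_le hQP
  have hM := hQ.conj_rpow (hP.rpow P p) (-(t / 2))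
  set M := Q ^ (-(t / 2)) * P ^ p * Q ^ (-(t / 2)) with hMdef
  have hpos : ∀ j : ℕ, 1 ≤ (p - t) * (j + 1 : ℕ) + t := by
    intro j
    push_cast
    nlinarith [mul_nonneg (by linarith : 0 ≤ p - t) (Nat.cast_nonneg (α := ℝ) j)]
  have e1 : Q ^ (-(t / 2)) * Q ^ (t / 2) = 1 := CFC.rpow_neg_mul_rpow _ hQ
  have e2 : Q ^ (t / 2) * Q ^ (-(t / 2)) = 1 := CFC.rpow_mul_rpow_neg _ hQ
  induction k with
  | zero =>
    rw [zero_add, pow_one, hMdef]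
    simp only [mul_assoc, e1, mul_one]
    rw [hQ.rpow_mul_rpow_mul (z := 0) (by ring), CFC.rpow_zero Q hQ.nonneg, one_mul,
      Nat.cast_one, hP.rpow_rpow_eq_self]
    rw [mul_one, sub_add_cancel, mul_inv_cancel₀ (by linarith)]
  | succ j ih =>
    set q := (p - t) * (j + 1 : ℕ) + t with hq
    have hq1 : 1 ≤ q := hpos j
    have hj : (0 : ℝ) < (j + 1 : ℕ) := by positivity
    have hMj : IsStrictlyPositive (M ^ (j + 1)) := by
      rw [← CFC.rpow_natCast M (j + 1) hM.nonneg]; exact hM.rpow M _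
    have hT := hQ.conj_rpow hMj (t / 2)
    set T := Q ^ (t / 2) * M ^ (j + 1) * Q ^ (t / 2) with hTdef
    have step := rpow_le_conj_rpow_conj hQ (hQP.trans ih) (p := q)
      (s := (j + 1 + 1 : ℕ) / (j + 1 : ℕ)) ht0 ht1
      (by rw [le_div_iff₀ hj]; push_cast; linarith)
      (by rw [div_le_iff₀ hj]; push_cast; linarith [Nat.cast_nonneg (α := ℝ) j])
    rw [hT.rpow_rpow_eq_self (inv_mul_cancel₀ (by linarith))] at step
    have e3 : Q ^ (-(t / 2)) * T * Q ^ (-(t / 2)) = M ^ (j + 1) := by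
      rw [hTdef]
      simp only [mul_assoc, e2, mul_one]
      rw [hQ.rpow_mul_rpow_mul (z := 0) (by ring), CFC.rpow_zero Q hQ.nonneg, one_mul]
    have e4 : (M ^ (j + 1)) ^ (((j + 1 + 1 : ℕ) : ℝ) / (j + 1 : ℕ)) = M ^ (j + 1 + 1) := by
      rw [← CFC.rpow_natCast M (j + 1) hM.nonneg, hM.rpow_mul, mul_div_cancel₀ _ hj.ne',
        CFC.rpow_natCast M _ hM.nonneg]
    have e5 : (q - t) * (((j + 1 + 1 : ℕ) : ℝ) / (j + 1 : ℕ)) + t =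
        (p - t) * (j + 1 + 1 : ℕ) + t := by
      rw [hq, add_sub_cancel_right]; field_simp
    rw [e3, e4, e5] at step
    have hq2 := hpos (j + 1)
    have h := CFC.rpow_le_rpow (p := ((p - t) * (j + 1 + 1 : ℕ) + t)⁻¹)
      ⟨by positivity, inv_le_one_of_one_le₀ hq2⟩ step
    rw [(hT.rpow T _).rpow_rpow_eq_self (mul_inv_cancel₀ (by linarith))] at h
    exact ih.trans h

/-- The **grand Furuta inequality** with a natural inner exponent, for strictly positive elements
of a C⋆-algebra. -/
theorem grand_furuta {P Q : 𝒜} (hQ : IsStrictlyPositive Q) (hQP : Q ≤ P) {p r t : ℝ}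
    (hp : 1 ≤ p) (ht0 : 0 ≤ t) (ht1 : t ≤ 1) (hr : t ≤ r) {k : ℕ} (hk : 1 ≤ k) :
    Q ^ (1 - t + r) ≤ (Q ^ (r / 2) * (Q ^ (-(t / 2)) * P ^ p * Q ^ (-(t / 2))) ^ k * Q ^ (r / 2)) ^
      ((1 - t + r) / ((p - t) * k + r)) := by
  obtain ⟨j, rfl⟩ : ∃ j, k = j + 1 := ⟨k - 1, by omega⟩
  have hP : IsStrictlyPositive P := hQ.of_le hQP
  have hM := hQ.conj_rpow (hP.rpow P p) (-(t / 2))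
  have h1 := le_conj_pow_conj_rpow hQ hQP hp ht0 ht1 j
  set M := Q ^ (-(t / 2)) * P ^ p * Q ^ (-(t / 2)) with hMdef
  have hMj : IsStrictlyPositive (M ^ (j + 1)) := by
    rw [← CFC.rpow_natCast M (j + 1) hM.nonneg]; exact hM.rpow M _
  have hq1 : 1 ≤ (p - t) * (j + 1 : ℕ) + t := by
    push_cast
    nlinarith [mul_nonneg (by linarith : 0 ≤ p - t) (Nat.cast_nonneg (α := ℝ) j)]
  -- Furuta's parameter is `r - t` because the root already contains `Q ^ (t / 2)` on each side.
  have hF := furuta hQ (hQP.trans h1) hq1 (sub_nonneg.mpr hr)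
  rw [(hQ.conj_rpow hMj (t / 2)).rpow_rpow_eq_self (inv_mul_cancel₀ (by linarith))] at hF
  rw [show 1 + (r - t) = 1 - t + r by ring,
    show (p - t) * (j + 1 : ℕ) + t + (r - t) = (p - t) * (j + 1 : ℕ) + r by ring] at hF
  simp only [mul_assoc] at hF ⊢
  rwa [hQ.rpow_mul_rpow (z := r / 2) (by ring), hQ.rpow_mul_rpow_mul (z := r / 2) (by ring)] at hF

end Furuta

/-! ### First-order perturbation of the `n`-th root. -/

section Perturbation

open Filter Topology

/-- The `n`-th root is Lipschitz at a power of a strictly positive element, as long as it only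
increases. -/
lemma IsStrictlyPositive.exists_norm_rpow_inv_sub_le {𝒜 : Type*} [CStarAlgebra 𝒜]
    [PartialOrder 𝒜] [StarOrderedRing 𝒜] {a : 𝒜} (ha : IsStrictlyPositive a) {n : ℕ} (hn : n ≠ 0) :
    ∃ K : ℝ, ∀ y : 𝒜, 0 ≤ y → a ≤ y ^ (n : ℝ)⁻¹ →
      ‖y ^ (n : ℝ)⁻¹ - a‖ ≤ K * ‖y - a ^ n‖ := by
  rcases subsingleton_or_nontrivial 𝒜 with h | h
  · exact ⟨0, fun y _ _ => by rw [Subsingleton.elim (y ^ (n : ℝ)⁻¹ - a) 0]; simp⟩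
  have han : IsStrictlyPositive (a ^ n) := by
    rw [← CFC.rpow_natCast a n ha.nonneg]; exact ha.rpow a _
  obtain ⟨ρ, hρ, hle⟩ := (CFC.exists_pos_algebraMap_le_iff han.isSelfAdjoint).2
    fun x hx => han.spectrum_pos hx
  have hnR : (0 : ℝ) < n := by positivity
  have hn1 : (1 : ℝ) ≤ n := by exact_mod_cast Nat.one_le_iff_ne_zero.mpr hn
  refine ⟨‖a‖ / ρ, fun y hy hay => ?_⟩
  set δ := ‖y - a ^ n‖ with hδ
  have hc : 0 ≤ δ / ρ := by positivity
  -- As `ρ ≤ a ^ n`, the error `δ` is absorbed into a multiple of `a ^ n`; monotonicity of the root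
  -- then gives `y ^ (1 / n) - a ≤ (δ / ρ) • a`.
  have h1 : y ≤ ((1 + δ / ρ) • a) ^ n := by
    have e1 : y - a ^ n ≤ algebraMap ℝ 𝒜 δ :=
      IsSelfAdjoint.le_algebraMap_norm_self (hy.isSelfAdjoint.sub han.isSelfAdjoint)
    have e2 : algebraMap ℝ 𝒜 δ ≤ (δ / ρ) • a ^ n := by
      refine le_trans (le_of_eq ?_) (smul_le_smul_of_nonneg_left hle hc)
      rw [Algebra.algebraMap_eq_smul_one, Algebra.algebraMap_eq_smul_one, smul_smul,
        div_mul_cancel₀ _ hρ.ne']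
    calc y = a ^ n + (y - a ^ n) := by abel
      _ ≤ a ^ n + (δ / ρ) • a ^ n := by gcongr; exact e1.trans e2
      _ = (1 + δ / ρ) • a ^ n := by rw [add_smul, one_smul]
      _ ≤ (1 + δ / ρ) ^ n • a ^ n :=
        smul_le_smul_of_nonneg_right (le_self_pow₀ (by linarith) hn) han.nonneg
      _ = ((1 + δ / ρ) • a) ^ n := (smul_pow _ _ _).symm
  have h2 := CFC.rpow_le_rpow (p := (n : ℝ)⁻¹) ⟨by positivity, inv_le_one_of_one_le₀ hn1⟩ h1
  have hs : IsStrictlyPositive ((1 + δ / ρ) • a) := ha.smul (by linarith)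
  rw [← CFC.rpow_natCast _ n hs.nonneg,
    hs.rpow_rpow_eq_self (mul_inv_cancel₀ hnR.ne'), add_smul, one_smul] at h2
  calc ‖y ^ (n : ℝ)⁻¹ - a‖ ≤ ‖(δ / ρ) • a‖ :=
        CStarAlgebra.norm_le_norm_of_nonneg_of_le (sub_nonneg.mpr hay)
          (sub_le_iff_le_add'.mpr h2)
    _ = ‖a‖ / ρ * δ := by rw [norm_smul, Real.norm_of_nonneg hc]; ring

variable {H : Type*} [NormedAddCommGroup H] [InnerProductSpace ℂ H]

/-- Norm-bounded families of operators have weak limits along ultrafilters. -/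
lemma exists_tendsto_inner_of_norm_le [CompleteSpace H] {ι : Type*} (F : Ultrafilter ι)
    (D : ι → H →L[ℂ] H) (K : ℝ)
    (hK : ∀ᶠ i in (F : Filter ι), ‖D i‖ ≤ K) :
    ∃ X : H →L[ℂ] H, ∀ v w,
      Tendsto (fun i => inner ℂ (D i v) w) (F : Filter ι) (𝓝 (inner ℂ (X v) w)) := by
  have hb : ∀ v w : H, ∀ᶠ i in (F : Filter ι), ‖inner ℂ (D i v) w‖ ≤ K * ‖v‖ * ‖w‖ := by
    intro v w
    filter_upwards [hK] with i hi
    refine (norm_inner_le_norm _ _).trans ?_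
    gcongr
    exact (D i).le_of_opNorm_le hi v
  have hex : ∀ v w : H, ∃ z : ℂ, ‖z‖ ≤ K * ‖v‖ * ‖w‖ ∧
      Tendsto (fun i => inner ℂ (D i v) w) (F : Filter ι) (𝓝 z) := by
    intro v w
    obtain ⟨z, hz, hlim⟩ := (isCompact_closedBall (0 : ℂ) (K * ‖v‖ * ‖w‖)).ultrafilter_le_nhds
      (F.map fun i => inner ℂ (D i v) w) (by
        rw [le_principal_iff]
        exact (hb v w).mono fun i hi => by simpa using hi)
    exact ⟨z, by simpa using hz, hlim⟩
  choose φ hφ hlim using hex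
  let f : H →ₗ⋆[ℂ] H →ₗ[ℂ] ℂ := LinearMap.mk₂'ₛₗ (starRingEnd ℂ) (RingHom.id ℂ) φ
    (fun v₁ v₂ w => tendsto_nhds_unique (hlim (v₁ + v₂) w) (by
      simpa only [map_add, inner_add_left] using (hlim v₁ w).add (hlim v₂ w)))
    (fun c v w => tendsto_nhds_unique (hlim (c • v) w) (by
      simpa only [map_smul, inner_smul_left, smul_eq_mul] using (hlim v w).const_mul _))
    (fun v w₁ w₂ => tendsto_nhds_unique (hlim v (w₁ + w₂)) (by
      simpa only [inner_add_right] using (hlim v w₁).add (hlim v w₂)))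
    (fun c v w => tendsto_nhds_unique (hlim v (c • w)) (by
      simpa only [inner_smul_right, smul_eq_mul, RingHom.id_apply] using (hlim v w).const_mul _))
  refine ⟨InnerProductSpace.continuousLinearMapOfBilin
    (f.mkContinuous₂ K fun v w => hφ v w), fun v w => ?_⟩
  rw [InnerProductSpace.continuousLinearMapOfBilin_apply]
  exact hlim v w

lemma isPositive_of_tendsto_inner {ι : Type*} {l : Filter ι} [l.NeBot] {D : ι → H →L[ℂ] H}
    {X : H →L[ℂ] H} (hD : ∀ᶠ i in l, (D i).IsPositive)
    (hX : ∀ v w, Tendsto (fun i => inner ℂ (D i v) w) l (𝓝 (inner ℂ (X v) w))) :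
    X.IsPositive := by
  rw [ContinuousLinearMap.isPositive_iff_complex]
  intro v
  have hcl : IsClosed {z : ℂ | ((RCLike.re z : ℝ) : ℂ) = z ∧ 0 ≤ RCLike.re z} :=
    (isClosed_eq (Complex.continuous_ofReal.comp Complex.continuous_re) continuous_id).inter
      (isClosed_le continuous_const Complex.continuous_re)
  refine hcl.mem_of_tendsto (hX v v) ?_
  filter_upwards [hD] with i hi
  exact (ContinuousLinearMap.isPositive_iff_complex _).mp hi v

/-- If `∑ A ^ (n - 1 - i) * D x * A ^ i` converges in norm for bounded positive `D x`, then its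
limit is again of this form with a positive operator. -/
lemma exists_isPositive_sum_eq_of_tendsto [CompleteSpace H] {ι : Type*} {l : Filter ι} [l.NeBot]
    {A E : H →L[ℂ] H} (hA : IsSelfAdjoint A) (n : ℕ) {D : ι → H →L[ℂ] H} {K : ℝ}
    (hD : ∀ᶠ i in l, (D i).IsPositive) (hK : ∀ᶠ i in l, ‖D i‖ ≤ K)
    (hE : Tendsto (fun x => ∑ i ∈ Finset.range n, A ^ (n - 1 - i) * D x * A ^ i) l (𝓝 E)) :
    ∃ X : H →L[ℂ] H, X.IsPositive ∧ ∑ i ∈ Finset.range n, A ^ (n - 1 - i) * X * A ^ i = E := by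
  have hF : ((Ultrafilter.of l : Ultrafilter ι) : Filter ι) ≤ l := Ultrafilter.of_le l
  obtain ⟨X, hX⟩ := exists_tendsto_inner_of_norm_le (Ultrafilter.of l) D K (hF hK)
  refine ⟨X, isPositive_of_tendsto_inner (hF hD) hX, ?_⟩
  -- Moving the left powers of `A` onto `w` leaves finitely many matrix coefficients of `T`, so weak
  -- convergence suffices.
  have hinner : ∀ (T : H →L[ℂ] H) (v w : H),
      inner ℂ ((∑ i ∈ Finset.range n, A ^ (n - 1 - i) * T * A ^ i) v) w =
        ∑ i ∈ Finset.range n, inner ℂ (T ((A ^ i) v)) ((A ^ (n - 1 - i)) w) := by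
    intro T v w
    rw [sum_apply, sum_inner]
    refine Finset.sum_congr rfl fun i _ => ?_
    have hs : ContinuousLinearMap.adjoint (A ^ (n - 1 - i)) = A ^ (n - 1 - i) :=
      (hA.pow (n - 1 - i)).star_eq
    rw [mul_apply_eq_comp, mul_apply_eq_comp,
      ← ContinuousLinearMap.adjoint_inner_right, hs]
  ext v
  refine ext_inner_right ℂ fun w => ?_
  refine tendsto_nhds_unique
    (f := fun x => inner ℂ ((∑ i ∈ Finset.range n, A ^ (n - 1 - i) * D x * A ^ i) v) w)
    (l := ((Ultrafilter.of l : Ultrafilter ι) : Filter ι)) ?_ ?_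
  · simp only [hinner]
    exact tendsto_finsetSum _ fun i _ => hX _ _
  · have : Continuous fun T : H →L[ℂ] H => inner ℂ (T v) w := by fun_prop
    exact (this.tendsto E).comp (hE.mono_left hF)

/-- If `Y` starts at `A ^ n` and its `n`-th root stays above `A`, then the derivative of `Y` at `0`
is the image of a positive operator under the derivative of `T ↦ T ^ n` at `A`. -/
theorem exists_isPositive_sum_eq_of_hasDerivAt [CompleteSpace H] {A E : H →L[ℂ] H}
    (hA : IsStrictlyPositive A) {n : ℕ} (hn : n ≠ 0) {Y : ℝ → H →L[ℂ] H}
    (hY : HasDerivAt Y E 0) (hY0 : Y 0 = A ^ n)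
    (hYpos : ∀ x, 0 < x → 0 ≤ Y x) (hAY : ∀ x, 0 < x → A ≤ Y x ^ (n : ℝ)⁻¹) :
    ∃ X : H →L[ℂ] H, X.IsPositive ∧ ∑ i ∈ Finset.range n, A ^ (n - 1 - i) * X * A ^ i = E := by
  obtain ⟨K, hK⟩ := hA.exists_norm_rpow_inv_sub_le hn
  set Z : ℝ → H →L[ℂ] H := fun x => Y x ^ (n : ℝ)⁻¹ with hZ
  have hnR : (n : ℝ) ≠ 0 := by exact_mod_cast hn
  have hZn : ∀ x, 0 < x → Z x ^ n = Y x := by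
    intro x hx
    rw [← CFC.rpow_natCast _ n CFC.rpow_nonneg,
      CFC.rpow_rpow_of_exponent_nonneg _ _ _ (by positivity) (by positivity) (hYpos x hx),
      inv_mul_cancel₀ hnR, CFC.rpow_one _ (hYpos x hx)]
  have hYO : (fun x => Y x - A ^ n) =O[𝓝[>] 0] fun x : ℝ => x := by
    have := hY.isBigO_sub
    simp only [hY0, sub_zero] at this
    exact this.mono nhdsWithin_le_nhds
  have hZO : (fun x => Z x - A) =O[𝓝[>] 0] fun x : ℝ => x := by
    refine Asymptotics.IsBigO.trans (Asymptotics.IsBigO.of_bound K ?_) hYO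
    filter_upwards [self_mem_nhdsWithin] with x hx
    exact hK (Y x) (hYpos x hx) (hAY x hx)
  have hZA : Tendsto Z (𝓝[>] 0) (𝓝 A) := by
    rw [← tendsto_sub_nhds_zero_iff]
    exact hZO.trans_tendsto (tendsto_id.mono_left nhdsWithin_le_nhds)
  obtain ⟨K', hK'⟩ := hZO.bound
  set S : (H →L[ℂ] H) → H →L[ℂ] H :=
    fun T => ∑ i ∈ Finset.range n, A ^ (n - 1 - i) * T * A ^ i with hS
  -- `Z` is not known to be differentiable; `Z x - A = O(x)` is enough to turn the remainder of `T ↦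
  -- T ^ n` at `A` into `o(x)`.
  have hpow : (fun x => Y x - A ^ n - S (Z x - A)) =o[𝓝[>] 0] fun x : ℝ => x := by
    have h1 := ((hasFDerivAt_pow' (𝕜 := ℝ) n (x := A)).isLittleO.comp_tendsto hZA).trans_isBigO hZO
    refine h1.congr' ?_ EventuallyEq.rfl
    filter_upwards [self_mem_nhdsWithin] with x hx
    simp only [Function.comp_apply, hZn x hx, hS, sum_apply]
    congr 1
  refine exists_isPositive_sum_eq_of_tendsto (l := 𝓝[>] (0 : ℝ)) hA.isSelfAdjoint n
    (D := fun x => x⁻¹ • (Z x - A)) (K := K') ?_ ?_ ?_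
  · filter_upwards [self_mem_nhdsWithin] with x hx
    rw [← ContinuousLinearMap.nonneg_iff_isPositive]
    exact smul_nonneg (inv_nonneg.mpr (le_of_lt hx)) (sub_nonneg.mpr (hAY x hx))
  · filter_upwards [self_mem_nhdsWithin, hK'] with x (hx : 0 < x) h
    rw [norm_smul, norm_inv, inv_mul_le_iff₀ (norm_pos_iff.mpr hx.ne'), mul_comm]
    exact h
  · have h1 : Tendsto (fun x : ℝ => x⁻¹ • (Y x - A ^ n)) (𝓝[>] 0) (𝓝 E) := by
      have := (hasDerivAt_iff_tendsto_slope.mp hY).mono_left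
        (nhdsWithin_mono 0 fun x (hx : 0 < x) => hx.ne')
      refine this.congr fun x => ?_
      rw [slope_def_module, hY0, sub_zero]
    have h2 : Tendsto (fun x : ℝ => x⁻¹ • (Y x - A ^ n - S (Z x - A))) (𝓝[>] 0) (𝓝 0) :=
      hpow.tendsto_inv_smul_nhds_zero
    have h3 := h1.sub h2
    rw [sub_zero] at h3
    refine h3.congr fun x => ?_
    rw [← smul_sub, sub_sub_cancel, hS, Finset.smul_sum]
    refine Finset.sum_congr rfl fun i _ => ?_
    rw [mul_smul_comm, smul_mul_assoc]

end Perturbation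

/-! ### Assembly of the operator equation. -/

lemma Finset.sum_Icc_one_eq_sum_range {M : Type*} [AddCommMonoid M] (f : ℕ → M) (n : ℕ) :
    ∑ j ∈ Finset.Icc 1 n, f j = ∑ i ∈ Finset.range n, f (i + 1) := by
  induction n with
  | zero => simp
  | succ n ih => rw [Finset.sum_Icc_succ_top (by omega), ih, Finset.sum_range_succ]

/-- The `n`-th root form of the grand Furuta inequality. -/
lemma rpow_le_grand_furuta_root {𝒜 : Type*} [CStarAlgebra 𝒜] [PartialOrder 𝒜] [StarOrderedRing 𝒜]
    {P Q : 𝒜} (hQ : IsStrictlyPositive Q) (hQP : Q ≤ P) {m n k : ℕ} (hm : 1 ≤ m) (hn : 1 ≤ n)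
    (hk : 1 ≤ k) {r t : ℝ} (ht0 : 0 ≤ t) (ht1 : t ≤ 1) (hr : t ≤ r)
    (hD : 0 < (m - t) * k + r) (h : (m - t) * k + r ≤ n * (1 - t + r)) :
    Q ^ (((m - t) * k + r) / n) ≤ (Q ^ (r / 2) *
      (Q ^ (-(t / 2)) * P ^ m * Q ^ (-(t / 2))) ^ k * Q ^ (r / 2)) ^ (n : ℝ)⁻¹ := by
  have hP : IsStrictlyPositive P := hQ.of_le hQP
  have hm1 : (1 : ℝ) ≤ m := by exact_mod_cast hm
  have hn0 : (0 : ℝ) < n := by exact_mod_cast hn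
  have hs : 0 < 1 - t + r := by linarith
  -- Löwner–Heinz with the exponent that turns the grand Furuta root into an `n`-th root; it is at
  -- most `1` by `h`.
  have hF := CFC.rpow_le_rpow (p := ((m - t) * k + r) / (n * (1 - t + r)))
    ⟨by positivity, by rwa [div_le_one (by positivity)]⟩
    (grand_furuta hQ hQP hm1 ht0 ht1 hr hk)
  have hM := hQ.conj_rpow (hP.rpow P m) (-(t / 2))
  have hMk := hM.rpow _ k
  rw [CFC.rpow_natCast _ k hM.nonneg] at hMk
  rw [hQ.rpow_mul, (hQ.conj_rpow hMk (r / 2)).rpow_mul, CFC.rpow_natCast P m hP.nonneg] at hF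
  have e1 : (1 - t + r) * (((m - t) * k + r) / (n * (1 - t + r))) = ((m - t) * k + r) / n := by
    field_simp
  have e2 : (1 - t + r) / ((m - t) * k + r) * (((m - t) * k + r) / (n * (1 - t + r))) =
      (n : ℝ)⁻¹ := by
    field_simp
  rwa [e1, e2] at hF

theorem theorem2p1 {H : Type*} [NormedAddCommGroup H] [InnerProductSpace ℂ H] [CompleteSpace H]
    (A B : H →L[ℂ] H) (hA : IsStrictlyPositive A) (hB : B.IsPositive)
    (m n k : ℕ) (hm : 1 ≤ m) (hn : 1 ≤ n) (hk : 1 ≤ k)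
    (t : ℝ) (ht : t ∈ Set.Icc (0 : ℝ) 1) (r : ℝ)
    (hr : ((m - t) * k ≤ (1 - t) * n ∧ t ≤ r) ∨
      ((1 - t) * n ≤ (m - t) * k ∧ 2 ≤ n ∧
        max (((m - t) * k - (1 - t) * n) / ((n : ℝ) - 1)) t ≤ r)) :
    ∃ X : H →L[ℂ] H, X.IsPositive ∧
      ∑ j ∈ Finset.Icc 1 n, A ^ (n - j) * X * A ^ (j - 1) =
        A ^ ((n * r) / (2 * (m - t) * k + 2 * r) : ℝ) *
          (∑ i ∈ Finset.Icc 1 k,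
            A ^ ((n * (m - t) * ((k : ℝ) - i)) / ((m - t) * k + r) : ℝ) *
              (A ^ (-(t / 2) * (n / ((m - t) * k + r)) : ℝ) *
                (∑ j ∈ Finset.Icc 1 m,
                  A ^ ((n * ((m : ℝ) - j)) / ((m - t) * k + r) : ℝ) * B *
                    A ^ ((n * ((j : ℝ) - 1)) / ((m - t) * k + r) : ℝ)) *
                A ^ (-(t / 2) * (n / ((m - t) * k + r)) : ℝ)) *
              A ^ ((n * (m - t) * ((i : ℝ) - 1)) / ((m - t) * k + r) : ℝ)) *
          A ^ ((n * r) / (2 * (m - t) * k + 2 * r) : ℝ) := by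
  obtain ⟨ht0, ht1⟩ := ht
  have hm1 : (1 : ℝ) ≤ m := by exact_mod_cast hm
  have hn1 : (1 : ℝ) ≤ n := by exact_mod_cast hn
  have hk1 : (1 : ℝ) ≤ k := by exact_mod_cast hk
  have htr : t ≤ r := by
    rcases hr with ⟨-, h⟩ | ⟨-, -, h⟩
    · exact h
    · exact (le_max_right _ _).trans h
  have hD : 0 < (m - t) * k + r := by
    nlinarith [mul_nonneg (sub_nonneg.mpr (ht1.trans hm1)) (sub_nonneg.mpr hk1)]
  -- In the second case this is the bound on `r` with the denominator `n - 1` cleared; in the first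
  -- it follows from `r ≤ n * r`.
  have hDn : (m - t) * k + r ≤ n * (1 - t + r) := by
    rcases hr with ⟨h, -⟩ | ⟨-, h2, h⟩
    · nlinarith [mul_nonneg (ht0.trans htr) (sub_nonneg.mpr hn1)]
    · have h2' : (2 : ℝ) ≤ n := by exact_mod_cast h2
      have h3 := (le_max_left _ _).trans h
      rw [div_le_iff₀ (by linarith)] at h3
      linarith
  set δ := (m - t) * k + r with hδ
  set C := A ^ (n / δ) with hC
  have hn0 : (n : ℝ) ≠ 0 := by linarith
  have hCp : IsStrictlyPositive C := hA.rpow A _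
  have hAC : ∀ x y : ℝ, y = n / δ * x → A ^ y = C ^ x := by
    rintro x y rfl
    rw [hC, hA.rpow_mul]
  have hCA : C ^ (δ / n) = A := hA.rpow_rpow_eq_self (by field_simp)
  have hB0 : 0 ≤ B := (ContinuousLinearMap.nonneg_iff_isPositive B).mpr hB
  set Y : ℝ → H →L[ℂ] H := fun x =>
    C ^ (r / 2) * (C ^ (-(t / 2)) * (C + x • B) ^ m * C ^ (-(t / 2))) ^ k * C ^ (r / 2) with hY
  have hlin : HasDerivAt (fun x : ℝ => C + x • B) B 0 := by
    simpa using ((hasDerivAt_id (0 : ℝ)).smul_const B).const_add C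
  -- The inner power rule produces the sum over `j`, the outer one the sum over `i`.
  have hder := (((((hlin.fun_pow' m).const_mul (C ^ (-(t / 2)))).mul_const
    (C ^ (-(t / 2)))).fun_pow' k).const_mul (C ^ (r / 2))).mul_const (C ^ (r / 2))
  have hM : C ^ (-(t / 2)) * C ^ m * C ^ (-(t / 2)) = C ^ (m - t) := by
    rw [← CFC.rpow_natCast C m hCp.nonneg, hCp.rpow_mul_rpow rfl,
      hCp.rpow_mul_rpow (z := m - t) (by ring)]
  have hMpow : ∀ i : ℕ, (C ^ (m - t)) ^ i = C ^ ((m - t) * i) := fun i => by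
    rw [← CFC.rpow_natCast _ i (hCp.rpow C _).nonneg, hCp.rpow_mul]
  have hle : ∀ x : ℝ, 0 < x → C ≤ C + x • B := fun x hx =>
    le_add_of_nonneg_right (smul_nonneg hx.le hB0)
  have hY0 : Y 0 = A ^ n := by
    simp only [hY, zero_smul, add_zero, hM, hMpow]
    rw [hCp.rpow_mul_rpow rfl, hCp.rpow_mul_rpow (z := δ) (by rw [hδ]; ring),
      ← CFC.rpow_natCast A n hA.nonneg]
    exact (hAC δ n (by field_simp)).symm
  have hYpos : ∀ x, 0 < x → 0 ≤ Y x := by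
    intro x hx
    have hP := hCp.of_le (hle x hx)
    have h1 := hCp.conj_rpow (hP.rpow _ m) (-(t / 2))
    have h2 := h1.rpow _ k
    rw [CFC.rpow_natCast _ k h1.nonneg, CFC.rpow_natCast _ m hP.nonneg] at h2
    exact (hCp.conj_rpow h2 (r / 2)).nonneg
  have hAY : ∀ x, 0 < x → A ≤ Y x ^ (n : ℝ)⁻¹ := by
    intro x hx
    have := rpow_le_grand_furuta_root hCp (hle x hx) hm hn hk ht0 ht1 htr hD hDn
    rwa [← hδ, hCA] at this
  obtain ⟨X, hX, hsum⟩ := exists_isPositive_sum_eq_of_hasDerivAt hA (Nat.one_le_iff_ne_zero.mp hn)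
    hder hY0 hYpos hAY
  refine ⟨X, hX, ?_⟩
  simp only [zero_smul, add_zero, hM, hMpow] at hsum
  simp only [Finset.sum_Icc_one_eq_sum_range]
  rw [hAC (r / 2) ((n * r) / (2 * (m - t) * k + 2 * r)) (by
      rw [show 2 * (m - t) * k + 2 * r = 2 * δ by rw [hδ]; ring]; field_simp),
    hAC (-(t / 2)) (-(t / 2) * (n / δ)) (mul_comm _ _)]
  convert hsum using 1
  · refine Finset.sum_congr rfl fun i _ => ?_
    rw [Nat.add_sub_cancel, Nat.sub_sub, Nat.add_comm 1 i]
  · congr 2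
    refine Finset.sum_congr rfl fun i hi => ?_
    have hik : i + 1 ≤ k := Finset.mem_range.mp hi
    have e : ((k.pred - i : ℕ) : ℝ) = k - (i + 1 : ℕ) := by
      rw [Nat.pred_eq_sub_one, Nat.sub_sub, Nat.add_comm 1 i, Nat.cast_sub hik]
    rw [hAC ((m - t) * (k.pred - i : ℕ)) _ (by rw [e]; ring),
      hAC ((m - t) * i) _ (by push_cast; ring)]
    congr 4
    refine Finset.sum_congr rfl fun j hj => ?_
    have hjm : j + 1 ≤ m := Finset.mem_range.mp hj
    have e' : ((m.pred - j : ℕ) : ℝ) = m - (j + 1 : ℕ) := by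
      rw [Nat.pred_eq_sub_one, Nat.sub_sub, Nat.add_comm 1 j, Nat.cast_sub hjm]
    rw [hAC (m.pred - j : ℕ) _ (by rw [e']; ring), hAC j _ (by push_cast; ring),
      CFC.rpow_natCast C _ hCp.nonneg, CFC.rpow_natCast C _ hCp.nonneg]
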